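/- Let $\mathcal Z$ be a countable connected graph with graph distance $\mathrm d$, whose balls $B_L(x)=\{y:\mathrm d(x,y)\le L\}$ satisfy $|B_L(x)|\le C_d L^d$ for all $x\in\mathcal Z$ and all integers $L\ge 1$. Let $V=(V(z))_{z\in\mathcal Z}$ be independent, identically distributed real random variables whose common distribution function $F_V$ satisfies $F_V(t+s)-F_V(t)\le C_W s$ for all $t\in\mathbb R$, $s\ge 0$, where $0<C_W<\infty$. For finite $\Lambda\subset\mathcal Z$ let $H_\Lambda=-\Delta_\Lambda+V$ be the discrete Schrödinger operator on $\ell^2(\Lambda)$ with Dirichlet boundary conditions, $$(H_\Lambda f)(x)=(n(x)+V(x))f(x)-\sum_{y\in\Lambda,\ \mathrm d(x,y)=1}f(y),$$ where $n(x)$ is the number of neighbours of $x$ in $\mathcal Z$. Let $G_\Lambda(x,y;E)$ be the matrix elements of $(H_\Lambda-E)^{-1}$, with $|G_\Lambda(x,y;E)|=+\infty$ by convention if $E$ is an eigenvalue of $H_\Lambda$. For fixed $L$ put $$M_x(E)=\max_{y\in\partial^-B_L(x)}|G_{B_L(x)}(x,y;E)|,$$ where $\partial^-B_L(x)$ is the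 set of vertices of $B_L(x)$ that have a neighbour outside $B_L(x)$. **Theorem.** Let $L\ge1$ be an integer, let $I\subset\mathbb R$ be an interval of length at most $1$, and let $a,b,c,P_L>0$ be such that $$b\le\min\{|B_L(u)|^{-1}\,a\,c^2,\ c\}\quad\text{for all }u\in\mathcal Z .$$ Suppose that for all $E\in I$ and all $x\in\mathcal Z$ $$\mathbb P\{M_x(E)\ge a\}\le P_L .$$ Then for any two disjoint balls $B_L(x),B_L(y)\subset\mathcal Z$ $$\mathbb P\{\exists\,E\in I:\ \min(M_x(E),M_y(E))>a\}\le 4C_W C_d^2L^{2d}\,c+\frac{2P_L}{b}.$$ -/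

import Mathlib

open MeasureTheory ProbabilityTheory
open scoped ENNReal

universe u v

namespace Anderson

/-- The balls of the graph are finite and of size at most `C L ^ d` for all radii `L ≥ 1`. -/
structure PolyGrowth {Z : Type u} (G : SimpleGraph Z) (C d : ℝ) : Prop where
  finite_ball : ∀ (x : Z) (L : ℕ), 1 ≤ L → {y | G.dist x y ≤ L}.Finite
  card_ball_le : ∀ (x : Z) (L : ℕ), 1 ≤ L →
    (({y | G.dist x y ≤ L}.ncard : ℕ) : ℝ) ≤ C * (L : ℝ) ^ d

theorem PolyGrowth.finite {Z : Type u} {G : SimpleGraph Z} {C d : ℝ} (hG : PolyGrowth G C d)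
    (x : Z) (L : ℕ) : {y | G.dist x y ≤ L}.Finite :=
  (hG.finite_ball x (L + 1) (Nat.le_add_left 1 L)).subset fun _ hy => Nat.le_succ_of_le hy

/-- The ball of radius `L` around `x` in the graph distance. -/
noncomputable def ball {Z : Type u} {G : SimpleGraph Z} {C d : ℝ} (hG : PolyGrowth G C d)
    (x : Z) (L : ℕ) : Finset Z :=
  (hG.finite x L).toFinset

theorem mem_ball {Z : Type u} {G : SimpleGraph Z} {C d : ℝ} (hG : PolyGrowth G C d)
    {x y : Z} {L : ℕ} : y ∈ ball hG x L ↔ G.dist x y ≤ L := by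
  simp [ball]

theorem self_mem_ball {Z : Type u} {G : SimpleGraph Z} {C d : ℝ} (hG : PolyGrowth G C d)
    (x : Z) (L : ℕ) : x ∈ ball hG x L := by
  simp [mem_ball]

/-- The inner boundary of `Λ`: the vertices of `Λ` at distance one from the complement of `Λ`. -/
def innerBoundary {Z : Type u} (G : SimpleGraph Z) (Λ : Finset Z) : Set Z :=
  {y | y ∈ Λ ∧ ∃ z, z ∉ Λ ∧ G.Adj y z}

/-- The number of nearest neighbours of `x` in the whole graph. -/
noncomputable def coordinationNumber {Z : Type u} (G : SimpleGraph Z) (x : Z) : ℕ :=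
  (G.neighborSet x).ncard

open Classical in
/-- The discrete Schrödinger operator `-Δ + v` in the finite volume `Λ` with Dirichlet boundary
conditions, in the basis of delta functions: the diagonal carries the number of neighbours in
the whole graph, the hopping terms are those inside `Λ`. All entries are real. -/
noncomputable def hamiltonian {Z : Type u} (G : SimpleGraph Z) (v : Z → ℝ) (Λ : Finset Z) :
    Matrix Λ Λ ℝ :=
  Matrix.of fun x y =>
    if x = y then (coordinationNumber G x : ℝ) + v x else if G.Adj x y then -1 else 0

open Classical in
/-- The modulus `|G_Λ(x, y; E)|` of the Green function, the matrix element of `(H_Λ - E)⁻¹`;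
it is `∞` when `E` is an eigenvalue of `H_Λ`. -/
noncomputable def greenAbs {Z : Type u} (G : SimpleGraph Z) (v : Z → ℝ) (Λ : Finset Z)
    (x y : Λ) (E : ℝ) : ℝ≥0∞ :=
  if E ∈ spectrum ℝ (hamiltonian G v Λ) then ∞
  else ENNReal.ofReal |(hamiltonian G v Λ - E • (1 : Matrix Λ Λ ℝ))⁻¹ x y|

/-- `M_x(E)`: the maximum of `|G_B(x, y; E)|` over `y` in the inner boundary of the ball `B` of
radius `L` around `x`. -/
noncomputable def greenMax {Z : Type u} {G : SimpleGraph Z} {C d : ℝ} (hG : PolyGrowth G C d)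
    (v : Z → ℝ) (L : ℕ) (x : Z) (E : ℝ) : ℝ≥0∞ :=
  ⨆ (y : ball hG x L) (_ : (y : Z) ∈ innerBoundary G (ball hG x L)),
    greenAbs G v (ball hG x L) ⟨x, self_mem_ball hG x L⟩ y E

/-- The random potential `V` is IID, and its marginal distribution function is Lipschitz
continuous with constant `C`. -/
structure IsLipschitzIID {Z : Type u} {Ω : Type v} [MeasurableSpace Ω] (μ : Measure Ω)
    (V : Z → Ω → ℝ) (C : ℝ) : Prop where
  measurable : ∀ z, Measurable (V z)
  indep : iIndepFun V μ
  ident : ∀ z w, IdentDistrib (V z) (V w) μ μ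
  lipschitz : ∀ (z : Z) (t s : ℝ), 0 ≤ s →
    cdf (μ.map (V z)) (t + s) - cdf (μ.map (V z)) t ≤ C * s

end Anderson

/-!
Write `w = V - E` for the potential of a ball measured from the energy, so that the Green function
of the ball is the inverse of `A + diagonal w` with a fixed symmetric matrix `A`, and raising the
energy lowers all coordinates of `w` simultaneously. A ball is called resonant at `E` when
`M_x(E) > a`, or when the determinant is so small that this has negligible probability; the second
alternative makes resonance an open condition on `E` that includes all eigenvalues.

*Crossings.* By Cramer's rule `|G(x, y; E)| > a` compares `|f(w)|` with `a |g(w)|`, where the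
numerator `f` and the determinant `g` are affine in every single coordinate of `w`. The difference
of the squares is quadratic in each coordinate, hence lowering one coordinate by `h` turns
`|f| ≤ a |g|` into `|f| > a |g|` only if this coordinate lies in a set of diameter `h`. Moving the
coordinates one after the other shows that raising the energy by `h` creates a new resonance with
probability at most `|B|² C_W h` (`pi_crossing_le`, `pi_resonantSet_crossing_le`).

*Union over energies.* Along an increasing sequence of energies a simultaneous resonance of two
balls is either present at the first energy or is entered by a crossing of one ball while the other
is resonant. The balls being disjoint, the latter has the product of the two probabilities, so the
probability of a common resonance in `I` is at most `P (1 + 2 |B|² C_W)`, with `P` the probability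
of a resonance at a fixed energy (`measure_biUnion_inter_resonanceEvent_le`). If the first term
`4 C_W C_d² L^(2d) c` of the claim is below one, then `b ≤ c` gives `2 |B|² C_W < 1 / (2 b)`, and
for `b ≤ 3 / 2` the second term `2 P_L / b` covers the part `P_L` of `P`, while the first
term absorbs the small excess `P - P_L`.

*Large `b`.* If `b > 3 / 2`, then `a` is at least `(3 / 2) |B| / c²`, and already a resonance of one
ball somewhere in `I` has probability below the first term. At a fixed energy this rests on a Wegner
estimate (`pi_iUnion_approxKernelSet_le`) bounding the inverse by `m`, combined with the equation of
row `x` for the inverse, which gains the factor `1 / |A x x + w x|`.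

The Wegner estimate itself uses a symmetric pairing: a large inverse produces a vector `ψ` with
supremum norm `1`, attained at some site `z`, and `‖(A + diagonal w) ψ‖₁ ≤ 1 / m`; two diagonals
differing only at `z` that admit such vectors differ there by at most `2 / m`.
-/

/-! ### Sets with short coordinate sections -/

theorem measure_Icc_le_of_cdf_lipschitz {ν : Measure ℝ} [IsProbabilityMeasure ν] {C : ℝ}
    (hν : ∀ t s : ℝ, 0 ≤ s → cdf ν (t + s) - cdf ν t ≤ C * s) {s t : ℝ} (hst : s ≤ t) :
    ν (Set.Icc s t) ≤ ENNReal.ofReal (C * (t - s)) := by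
  have key : ∀ η : ℝ, 0 < η → ν (Set.Icc s t) ≤ ENNReal.ofReal (C * (t - s + η)) := by
    intro η hη
    calc ν (Set.Icc s t) ≤ ν (Set.Ioc (s - η) t) :=
          measure_mono fun z hz => ⟨by linarith [hz.1], hz.2⟩
      _ = (cdf ν).measure (Set.Ioc (s - η) t) := by rw [measure_cdf]
      _ = ENNReal.ofReal (cdf ν t - cdf ν (s - η)) := StieltjesFunction.measure_Ioc _ _ _
      _ ≤ ENNReal.ofReal (C * (t - s + η)) := by
          apply ENNReal.ofReal_le_ofReal
          have := hν (s - η) (t - s + η) (by linarith)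
          rwa [show s - η + (t - s + η) = t by ring] at this
  have hlim : Filter.Tendsto (fun η : ℝ => ENNReal.ofReal (C * (t - s + η)))
      (nhdsWithin 0 (Set.Ioi 0)) (nhds (ENNReal.ofReal (C * (t - s)))) := by
    have : Continuous fun η : ℝ => ENNReal.ofReal (C * (t - s + η)) :=
      ENNReal.continuous_ofReal.comp (by fun_prop)
    simpa using (this.tendsto 0).mono_left nhdsWithin_le_nhds
  exact ge_of_tendsto hlim (by filter_upwards [self_mem_nhdsWithin] with η hη using key η hη)

theorem measure_le_of_forall_abs_sub_le {ν : Measure ℝ} {C ℓ : ℝ}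
    (hν : ∀ s t : ℝ, s ≤ t → ν (Set.Icc s t) ≤ ENNReal.ofReal (C * (t - s))) (hℓ : 0 ≤ ℓ)
    {S : Set ℝ} (hS : ∀ s ∈ S, ∀ t ∈ S, |s - t| ≤ ℓ) : ν S ≤ ENNReal.ofReal (C * ℓ) := by
  rcases S.eq_empty_or_nonempty with rfl | ⟨r, hr⟩
  · simp
  have hbdd : BddBelow S := ⟨r - ℓ, fun t ht => by linarith [(abs_le.mp (hS r hr t ht)).2]⟩
  have hsub : S ⊆ Set.Icc (sInf S) (sInf S + ℓ) := by
    intro t ht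
    refine ⟨csInf_le hbdd ht, ?_⟩
    have : t - ℓ ≤ sInf S :=
      le_csInf ⟨r, hr⟩ fun s hs => by linarith [(abs_le.mp (hS t ht s hs)).2]
    linarith
  calc ν S ≤ ν (Set.Icc (sInf S) (sInf S + ℓ)) := measure_mono hsub
    _ ≤ ENNReal.ofReal (C * (sInf S + ℓ - sInf S)) := hν _ _ (by linarith)
    _ = ENNReal.ofReal (C * ℓ) := by rw [add_sub_cancel_left]

/-- Fubini: if along the `i`-th coordinate a set has sections of diameter at most `ℓ`, then its
probability is controlled by the modulus of continuity of the `i`-th marginal alone. -/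
theorem pi_le_of_section_diam {n : Type*} [Fintype n] [DecidableEq n] {ν : n → Measure ℝ}
    [∀ i, IsProbabilityMeasure (ν i)] {C ℓ : ℝ} (i : n)
    (hν : ∀ s t : ℝ, s ≤ t → ν i (Set.Icc s t) ≤ ENNReal.ofReal (C * (t - s))) (hℓ : 0 ≤ ℓ)
    {B : Set (n → ℝ)} (hB : MeasurableSet B)
    (h : ∀ w s t, Function.update w i s ∈ B → Function.update w i t ∈ B → |s - t| ≤ ℓ) :
    Measure.pi ν B ≤ ENNReal.ofReal (C * ℓ) := by
  have hmeas : Measurable (B.indicator (1 : (n → ℝ) → ℝ≥0∞)) := measurable_one.indicator hB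
  have hle := lintegral_le_of_lmarginal_le (μ := ν) {i} hmeas
    (measurable_const (a := ENNReal.ofReal (C * ℓ))) (by
      intro w
      rw [lmarginal_singleton, lmarginal_singleton]
      simp only [lintegral_const, measure_univ, mul_one]
      have : (fun t => B.indicator (1 : (n → ℝ) → ℝ≥0∞) (Function.update w i t))
          = (Function.update w i ⁻¹' B).indicator 1 := rfl
      rw [this, lintegral_indicator_one ((measurable_update w) hB)]
      exact measure_le_of_forall_abs_sub_le hν hℓ fun s hs t ht => h w s t hs ht)
  rwa [lintegral_indicator_one hB, lintegral_const, measure_univ, mul_one] at hle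

/-! ### Upcrossings of coordinatewise affine functions -/

/-- A function of finitely many real variables that is affine in each of them separately. -/
def IsCoordAffine {n : Type*} [DecidableEq n] (f : (n → ℝ) → ℝ) : Prop :=
  ∀ w i, ∃ α β : ℝ, ∀ t, f (Function.update w i t) = α + β * t

theorem isCoordAffine_const {n : Type*} [DecidableEq n] (r : ℝ) :
    IsCoordAffine fun _ : n → ℝ => r := fun _ _ => ⟨r, 0, fun _ => by ring⟩

theorem IsCoordAffine.comp_sub {n : Type*} [DecidableEq n] {f : (n → ℝ) → ℝ}
    (hf : IsCoordAffine f) (u : n → ℝ) : IsCoordAffine fun w => f (w - u) := by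
  intro w i
  obtain ⟨α, β, h⟩ := hf (w - u) i
  refine ⟨α - β * u i, β, fun t => ?_⟩
  have : Function.update w i t - u = Function.update (w - u) i (t - u i) := by
    ext j
    by_cases hj : j = i
    · subst hj; simp
    · simp [hj]
  change f (Function.update w i t - u) = _
  rw [this, h]
  ring

/-- The set of upward crossings `{t | q (t - h) > 0 ≥ q t}` of a quadratic function has diameter at
most `h`, since the sign pattern `+, -, +, -` would require three sign changes. -/
theorem abs_sub_le_of_quadratic_crossing {A B C h s t : ℝ} (hh : 0 ≤ h)
    (hs : 0 < A * (s - h) ^ 2 + B * (s - h) + C) (hs' : A * s ^ 2 + B * s + C ≤ 0)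
    (ht : 0 < A * (t - h) ^ 2 + B * (t - h) + C) (ht' : A * t ^ 2 + B * t + C ≤ 0) :
    |s - t| ≤ h := by
  -- the values at `p < q < r` bound the leading coefficient from both sides
  have convex : ∀ p q r : ℝ, p < q → q < r →
      (r - p) * (A * q ^ 2 + B * q + C) = (r - q) * (A * p ^ 2 + B * p + C)
        + (q - p) * (A * r ^ 2 + B * r + C) - A * ((r - q) * (q - p) * (r - p)) := by
    intro p q r _ _; ring
  have main : ∀ s t : ℝ, 0 < A * (s - h) ^ 2 + B * (s - h) + C → A * s ^ 2 + B * s + C ≤ 0 →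
      0 < A * (t - h) ^ 2 + B * (t - h) + C → A * t ^ 2 + B * t + C ≤ 0 → t - s ≤ h := by
    intro s t hs hs' ht ht'
    by_contra! hlt
    have h1 : s - h < s := by
      rcases hh.lt_or_eq with h0 | h0
      · linarith
      · rw [← h0, sub_zero] at hs; linarith
    have h2 : s < t - h := by linarith
    have h3 : t - h < t := by linarith
    have e1 := convex _ _ _ h1 h2
    have e2 := convex _ _ _ h2 h3
    have p1 : 0 < (t - h - s) * (s - (s - h)) * (t - h - (s - h)) := by
      have := sub_pos.2 h1; have := sub_pos.2 h2; have := sub_pos.2 (h1.trans h2); positivity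
    have p2 : 0 < (t - (t - h)) * (t - h - s) * (t - s) := by
      have := sub_pos.2 h3; have := sub_pos.2 h2; have := sub_pos.2 (h2.trans h3); positivity
    have hA : 0 < A := by
      by_contra! hA
      have := mul_nonneg (neg_nonneg.2 hA) p1.le
      have := mul_pos (sub_pos.2 h2) hs
      have := mul_pos (sub_pos.2 h1) ht
      have := mul_nonpos_of_nonneg_of_nonpos (sub_pos.2 (h1.trans h2)).le hs'
      linarith
    have := mul_pos hA p2
    have := mul_pos (sub_pos.2 (h2.trans h3)) ht
    have := mul_nonpos_of_nonneg_of_nonpos (sub_pos.2 h3).le hs'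
    have := mul_nonpos_of_nonneg_of_nonpos (sub_pos.2 h2).le ht'
    linarith
  have := main s t hs hs' ht ht'
  have := main t s ht ht' hs hs'
  exact abs_le.2 ⟨by linarith, by linarith⟩

theorem measurableSet_mul_abs_lt {n : Type*} [Fintype n] {f g : (n → ℝ) → ℝ}
    (hfc : Continuous f) (hgc : Continuous g) (a : ℝ) : MeasurableSet {w | a * |g w| < |f w|} :=
  (isOpen_lt (by fun_prop) (by fun_prop)).measurableSet

/-- One coordinate at a time: lowering the coordinates in `S` by `h` makes `|f|` exceed `a |g|`
with probability at most `|S| C h`. -/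
theorem pi_crossing_finset_le {n : Type*} [Fintype n] [DecidableEq n] {ν : n → Measure ℝ}
    [∀ i, IsProbabilityMeasure (ν i)] {C h a : ℝ} (hC : 0 ≤ C)
    (hν : ∀ i, ∀ s t : ℝ, s ≤ t → ν i (Set.Icc s t) ≤ ENNReal.ofReal (C * (t - s)))
    (hh : 0 ≤ h) (ha : 0 ≤ a) {f g : (n → ℝ) → ℝ} (hf : IsCoordAffine f) (hg : IsCoordAffine g)
    (hfc : Continuous f) (hgc : Continuous g) (S : Finset n) :
    Measure.pi ν {w | a * |g (w - fun i => if i ∈ S then h else 0)|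
        < |f (w - fun i => if i ∈ S then h else 0)| ∧ |f w| ≤ a * |g w|}
      ≤ ENNReal.ofReal (S.card * (C * h)) := by
  induction S using Finset.induction_on with
  | empty =>
    have : {w : n → ℝ | a * |g (w - fun i => if i ∈ (∅ : Finset n) then h else 0)|
        < |f (w - fun i => if i ∈ (∅ : Finset n) then h else 0)| ∧ |f w| ≤ a * |g w|} = ∅ := by
      ext w
      have h0 : (w - fun i => if i ∈ (∅ : Finset n) then h else 0) = w := by ext; simp
      rw [Set.mem_ofPred_eq, h0]
      simp only [Set.mem_empty_iff_false, iff_false, not_and, not_le]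
      exact id
    rw [this]; simp
  | insert i S hi ih =>
    set uS : n → ℝ := fun j => if j ∈ S then h else 0 with huS
    set uT : n → ℝ := fun j => if j ∈ insert i S then h else 0 with huT
    have hupd : ∀ w t, Function.update w i t - uT = Function.update (w - uS) i (t - h) := by
      intro w t; ext j
      by_cases hj : j = i
      · subst hj; simp [huT]
      · simp [huT, huS, hj]
    have hupd' : ∀ w t, Function.update w i t - uS = Function.update (w - uS) i t := by
      intro w t; ext j
      by_cases hj : j = i
      · subst hj; simp [huS, hi]
      · simp [huS, hj]
    have hstep : Measure.pi ν {w | a * |g (w - uT)| < |f (w - uT)|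
        ∧ |f (w - uS)| ≤ a * |g (w - uS)|} ≤ ENNReal.ofReal (C * h) := by
      refine pi_le_of_section_diam i (hν i) hh ?_ ?_
      · refine (measurableSet_mul_abs_lt (f := fun w => f (w - uT)) (g := fun w => g (w - uT))
          (by fun_prop) (by fun_prop) a).inter ?_
        exact (isClosed_le (f := fun w => |f (w - uS)|) (g := fun w => a * |g (w - uS)|)
          (by fun_prop) (by fun_prop)).measurableSet
      · intro w s t hs ht
        obtain ⟨α, β, hαβ⟩ := hf (w - uS) i
        obtain ⟨γ, δ, hγδ⟩ := hg (w - uS) i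
        simp only [Set.mem_ofPred_eq, hupd, hupd', hαβ, hγδ] at hs ht
        have sq : ∀ p q : ℝ, a * |q| < |p| ↔ 0 < p ^ 2 - a ^ 2 * q ^ 2 := by
          intro p q
          rw [← abs_of_nonneg ha, ← abs_mul, ← sq_lt_sq, sub_pos, mul_pow, sq_abs]
        have sq' : ∀ p q : ℝ, |p| ≤ a * |q| ↔ p ^ 2 - a ^ 2 * q ^ 2 ≤ 0 := by
          intro p q
          rw [← not_lt, sq, not_lt]
        rw [sq, sq'] at hs ht
        refine abs_sub_le_of_quadratic_crossing (A := β ^ 2 - a ^ 2 * δ ^ 2)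
          (B := 2 * α * β - 2 * a ^ 2 * γ * δ) (C := α ^ 2 - a ^ 2 * γ ^ 2) hh ?_ ?_ ?_ ?_
        · linarith [hs.1]
        · linarith [hs.2]
        · linarith [ht.1]
        · linarith [ht.2]
    calc _ ≤ Measure.pi ν ({w | a * |g (w - uS)| < |f (w - uS)| ∧ |f w| ≤ a * |g w|} ∪
          {w | a * |g (w - uT)| < |f (w - uT)| ∧ |f (w - uS)| ≤ a * |g (w - uS)|}) := by
          refine measure_mono fun w hw => ?_
          rcases lt_or_ge (a * |g (w - uS)|) |f (w - uS)| with h1 | h1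
          · exact Or.inl ⟨h1, hw.2⟩
          · exact Or.inr ⟨hw.1, h1⟩
      _ ≤ _ := measure_union_le _ _
      _ ≤ ENNReal.ofReal (S.card * (C * h)) + ENNReal.ofReal (C * h) := add_le_add ih hstep
      _ = ENNReal.ofReal ((insert i S).card * (C * h)) := by
          rw [← ENNReal.ofReal_add (by positivity) (by positivity), Finset.card_insert_of_notMem hi]
          push_cast; ring_nf

theorem pi_crossing_le {n : Type*} [Fintype n] [DecidableEq n] {ν : n → Measure ℝ}
    [∀ i, IsProbabilityMeasure (ν i)] {C h a : ℝ} (hC : 0 ≤ C)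
    (hν : ∀ i, ∀ s t : ℝ, s ≤ t → ν i (Set.Icc s t) ≤ ENNReal.ofReal (C * (t - s)))
    (hh : 0 ≤ h) (ha : 0 ≤ a) {f g : (n → ℝ) → ℝ} (hf : IsCoordAffine f) (hg : IsCoordAffine g)
    (hfc : Continuous f) (hgc : Continuous g) :
    Measure.pi ν {w | a * |g (w - fun _ => h)| < |f (w - fun _ => h)| ∧ |f w| ≤ a * |g w|}
      ≤ ENNReal.ofReal (Fintype.card n * (C * h)) := by
  simpa using pi_crossing_finset_le hC hν hh ha hf hg hfc hgc Finset.univ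

/-! ### Events indexed by an energy -/

/-- Along an increasing sequence of energies every event of the union is either the first one or
entered by a crossing, so that the union costs one event and the crossings. -/
theorem measure_biUnion_finset_le_of_crossing {Ω : Type*} [MeasurableSpace Ω] {μ : Measure Ω}
    {I : Set ℝ}
    {A : ℝ → Set Ω} {p D : ℝ} (hp : 0 ≤ p) (hD : 0 ≤ D) (hA : ∀ e ∈ I, μ (A e) ≤ ENNReal.ofReal p)
    (hcross : ∀ e ∈ I, ∀ e' ∈ I, e ≤ e' → μ (A e' \ A e) ≤ ENNReal.ofReal (D * (e' - e)))
    (hlen : ∀ e ∈ I, ∀ e' ∈ I, e' - e ≤ 1) (F : Finset ℝ) (hF : ↑F ⊆ I) :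
    μ (⋃ e ∈ F, A e) ≤ ENNReal.ofReal (p + D) := by
  have key : ∀ F : Finset ℝ, ↑F ⊆ I → ∀ hne : F.Nonempty,
      μ (⋃ e ∈ F, A e) ≤ ENNReal.ofReal (p + D * (F.max' hne - F.min' hne)) := by
    intro F
    induction F using Finset.induction_on_max with
    | empty => intro _ hne; exact absurd hne Finset.not_nonempty_empty
    | insert e F hmax ih =>
      intro hFI hne
      rw [Finset.coe_insert, Set.insert_subset_iff] at hFI
      rcases F.eq_empty_or_nonempty with rfl | hF'
      · simpa using hA e hFI.1
      have hem : F.max' hF' < e := hmax _ (F.max'_mem hF')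
      have hmin : (insert e F).min' hne = F.min' hF' := by
        rw [Finset.min'_insert _ _ hF', min_eq_right]
        exact ((F.min'_le _ (F.max'_mem hF')).trans hem.le)
      have hmaxe : (insert e F).max' hne = e := by
        rw [Finset.max'_insert _ _ hF', max_eq_left hem.le]
      rw [hmin, hmaxe]
      have hmm : F.min' hF' ≤ F.max' hF' := F.min'_le _ (F.max'_mem hF')
      calc μ (⋃ e' ∈ insert e F, A e')
          ≤ μ ((⋃ e' ∈ F, A e') ∪ (A e \ A (F.max' hF'))) := by
            refine measure_mono fun ω hω => ?_
            simp only [Set.mem_iUnion, Finset.mem_insert, exists_prop] at hω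
            obtain ⟨e', rfl | he', hω⟩ := hω
            · by_cases h1 : ω ∈ A (F.max' hF')
              · exact Or.inl (Set.mem_biUnion (F.max'_mem hF') h1)
              · exact Or.inr ⟨hω, h1⟩
            · exact Or.inl (Set.mem_biUnion he' hω)
        _ ≤ _ := measure_union_le _ _
        _ ≤ ENNReal.ofReal (p + D * (F.max' hF' - F.min' hF'))
            + ENNReal.ofReal (D * (e - F.max' hF')) :=
            add_le_add (ih hFI.2 hF')
              (hcross _ (hFI.2 (F.max'_mem hF')) _ hFI.1 hem.le)
        _ = ENNReal.ofReal (p + D * (e - F.min' hF')) := by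
            rw [← ENNReal.ofReal_add]
            · congr 1; ring
            · have := mul_nonneg hD (sub_nonneg.2 hmm); linarith
            · exact mul_nonneg hD (sub_nonneg.2 hem.le)
  rcases F.eq_empty_or_nonempty with rfl | hne
  · simp
  refine (key F hF hne).trans (ENNReal.ofReal_le_ofReal ?_)
  have := mul_le_mul_of_nonneg_left (hlen _ (hF (F.min'_mem hne)) _ (hF (F.max'_mem hne))) hD
  linarith

/-- The crossing bound passes from finite sets of energies to an interval when each configuration
lies in `A e` for an open set of energies `e`. -/
theorem measure_biUnion_le_of_crossing {Ω : Type*} [MeasurableSpace Ω] {μ : Measure Ω} {I : Set ℝ}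
    {A : ℝ → Set Ω} {p D : ℝ} (hp : 0 ≤ p) (hD : 0 ≤ D) (hA : ∀ e ∈ I, μ (A e) ≤ ENNReal.ofReal p)
    (hcross : ∀ e ∈ I, ∀ e' ∈ I, e ≤ e' → μ (A e' \ A e) ≤ ENNReal.ofReal (D * (e' - e)))
    (hlen : ∀ e ∈ I, ∀ e' ∈ I, e' - e ≤ 1) (hopen : ∀ ω, IsOpen {e | ω ∈ A e}) :
    μ (⋃ e ∈ I, A e) ≤ ENNReal.ofReal (p + D) := by
  obtain ⟨S, hSc, hSd⟩ := TopologicalSpace.exists_countable_dense I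
  have hsub : (⋃ e ∈ I, A e) ⊆ ⋃ e : S, A (e : I) := by
    intro ω hω
    simp only [Set.mem_iUnion, exists_prop] at hω
    obtain ⟨e, he, hω⟩ := hω
    obtain ⟨e', he', heS⟩ := hSd.inter_open_nonempty
      (Subtype.val ⁻¹' {e : ℝ | ω ∈ A e} : Set I) ((hopen ω).preimage continuous_subtype_val)
      ⟨⟨e, he⟩, hω⟩
    exact Set.mem_iUnion.2 ⟨⟨e', heS⟩, he'⟩
  have : Countable S := hSc.to_subtype
  refine (measure_mono hsub).trans ?_
  classical
  rw [Set.iUnion_eq_iUnion_finset, Directed.measure_iUnion]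
  · refine iSup_le fun F => ?_
    refine le_trans (measure_mono ?_)
      (measure_biUnion_finset_le_of_crossing hp hD hA hcross hlen
        (F.image fun e : S => ((e : I) : ℝ)) ?_)
    · intro ω hω
      simp only [Set.mem_iUnion, exists_prop] at hω ⊢
      obtain ⟨e, he, hω⟩ := hω
      exact ⟨_, Finset.mem_image_of_mem _ he, hω⟩
    · intro e he
      rw [Finset.mem_coe, Finset.mem_image] at he
      obtain ⟨e', _, rfl⟩ := he
      exact e'.1.2
  · exact Monotone.directed_le fun F F' hFF' => Set.biUnion_subset_biUnion_left hFF'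

theorem sub_le_one_of_volume_le {I : Set ℝ} (hI : I.OrdConnected) (hI_len : volume I ≤ 1) :
    ∀ e ∈ I, ∀ e' ∈ I, e' - e ≤ 1 := by
  intro e he e' he'
  have h := (measure_mono (hI.out he he')).trans hI_len
  rw [Real.volume_Icc] at h
  simpa using h

/-! ### Matrices with variable diagonal -/

section VariableDiagonal

open Matrix

theorem abs_dotProduct_le_of_abs_le_one {n : Type*} [Fintype n] {ψ φ : n → ℝ} (h : ∀ i, |ψ i| ≤ 1) :
    |ψ ⬝ᵥ φ| ≤ ∑ i, |φ i| := by
  refine (Finset.abs_sum_le_sum_abs _ _).trans (Finset.sum_le_sum fun i _ => ?_)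
  rw [abs_mul]
  exact mul_le_of_le_one_left (abs_nonneg _) (h i)

theorem add_diagonal_update {n : Type*} [DecidableEq n] (A : Matrix n n ℝ) (w : n → ℝ) (i : n)
    (t : ℝ) :
    A + diagonal (Function.update w i t) =
      (A + diagonal (Function.update w i 0)).updateRow i
        ((A + diagonal (Function.update w i 0)).row i + t • Pi.single i 1) := by
  ext j k
  by_cases hj : j = i
  · subst hj
    by_cases hk : k = j
    · subst hk; simp
    · simp [hk, diagonal_apply_ne' _ hk]
  · simp only [updateRow_ne hj, Matrix.add_apply, diagonal_apply, Function.update_of_ne hj]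

variable {n : Type*} [Fintype n] [DecidableEq n]

theorem isCoordAffine_det_add_diagonal (A : Matrix n n ℝ) :
    IsCoordAffine fun w : n → ℝ => (A + diagonal w).det := by
  intro w i
  set B := A + diagonal (Function.update w i 0) with hB
  refine ⟨(B.updateRow i (B.row i)).det, (B.updateRow i (Pi.single i 1)).det, fun t => ?_⟩
  beta_reduce
  rw [add_diagonal_update, ← hB, det_updateRow_add, det_updateRow_smul, mul_comm t]

theorem isCoordAffine_adjugate_add_diagonal (A : Matrix n n ℝ) (x y : n) :
    IsCoordAffine fun w : n → ℝ => (A + diagonal w).adjugate x y := by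
  intro w i
  simp only [adjugate_apply]
  by_cases hi : i = y
  · subst hi
    refine ⟨((A + diagonal (Function.update w i 0)).updateRow i (Pi.single x 1)).det, 0,
      fun t => ?_⟩
    rw [add_diagonal_update, updateRow_idem]
    ring
  · set B := A + diagonal (Function.update w i 0) with hB
    refine ⟨((B.updateRow y (Pi.single x 1)).updateRow i (B.row i)).det,
      ((B.updateRow y (Pi.single x 1)).updateRow i (Pi.single i 1)).det, fun t => ?_⟩
    rw [add_diagonal_update, ← hB, updateRow_comm _ hi, det_updateRow_add, det_updateRow_smul,
      mul_comm t]

theorem continuous_det_add_diagonal (A : Matrix n n ℝ) :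
    Continuous fun w : n → ℝ => (A + diagonal w).det :=
  (continuous_const.add continuous_id.matrix_diagonal).matrix_det

theorem continuous_adjugate_add_diagonal (A : Matrix n n ℝ) (x y : n) :
    Continuous fun w : n → ℝ => (A + diagonal w).adjugate x y :=
  (continuous_const.add continuous_id.matrix_diagonal).matrix_adjugate.matrix_elem x y

/-! ### A Wegner estimate -/

/-- The diagonals `w` for which `A + diagonal w` has an approximate kernel vector of accuracy
`m⁻¹` in `ℓ¹`, normalized so that it attains its supremum norm `1` at the site `z`. -/
def approxKernelSet (A : Matrix n n ℝ) (m : ℝ) (z : n) : Set (n → ℝ) :=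
  {w | ∃ ψ : n → ℝ, ψ z = 1 ∧ (∀ i, |ψ i| ≤ 1) ∧ m * ∑ i, |((A + diagonal w) *ᵥ ψ) i| ≤ 1}

theorem isClosed_approxKernelSet (A : Matrix n n ℝ) (m : ℝ) (z : n) :
    IsClosed (approxKernelSet A m z) := by
  have : CompactSpace (Set.Icc (-1 : n → ℝ) 1) := isCompact_iff_compactSpace.1 isCompact_Icc
  have hmul : Continuous fun p : Set.Icc (-1 : n → ℝ) 1 × (n → ℝ) =>
      (A + diagonal p.2) *ᵥ (p.1 : n → ℝ) :=
    (continuous_const.add continuous_snd.matrix_diagonal).matrix_mulVec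
      (continuous_subtype_val.comp continuous_fst)
  have hcl : IsClosed {p : Set.Icc (-1 : n → ℝ) 1 × (n → ℝ) | (p.1 : n → ℝ) z = 1 ∧
      m * ∑ i, |((A + diagonal p.2) *ᵥ (p.1 : n → ℝ)) i| ≤ 1} := by
    have h1 : Continuous fun p : Set.Icc (-1 : n → ℝ) 1 × (n → ℝ) => (p.1 : n → ℝ) z :=
      (continuous_apply z).comp (continuous_subtype_val.comp continuous_fst)
    have h2 : Continuous fun p : Set.Icc (-1 : n → ℝ) 1 × (n → ℝ) =>
        m * ∑ i, |((A + diagonal p.2) *ᵥ (p.1 : n → ℝ)) i| :=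
      continuous_const.mul (continuous_finsetSum _ fun i _ =>
        ((continuous_apply i).comp hmul).abs)
    exact (isClosed_eq h1 continuous_const).inter (isClosed_le h2 continuous_const)
  convert isClosedMap_snd_of_compactSpace _ hcl using 1
  ext w
  constructor
  · rintro ⟨ψ, h1, h2, h3⟩
    exact ⟨(⟨ψ, fun i => (abs_le.1 (h2 i)).1, fun i => (abs_le.1 (h2 i)).2⟩, w), ⟨h1, h3⟩, rfl⟩
  · rintro ⟨⟨ψ, w'⟩, ⟨h1, h3⟩, rfl⟩
    exact ⟨ψ, h1, fun i => abs_le.2 ⟨ψ.2.1 i, ψ.2.2 i⟩, h3⟩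

/-- If `ψ` and `φ` are approximate kernel vectors at two diagonals differing only at `z`, then by
symmetry of `A` the difference at `z` is the difference of two pairings, both small by
`ℓ¹`-`ℓ^∞` duality. -/
theorem approxKernelSet_section {A : Matrix n n ℝ} (hA : A.IsSymm) {m : ℝ} (hm : 0 < m) (z : n)
    (w : n → ℝ) (s t : ℝ) (hs : Function.update w z s ∈ approxKernelSet A m z)
    (ht : Function.update w z t ∈ approxKernelSet A m z) : |s - t| ≤ 2 / m := by
  obtain ⟨ψ, hψz, hψ, hs⟩ := hs
  obtain ⟨φ, hφz, hφ, ht⟩ := ht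
  have hAsym : φ ⬝ᵥ A *ᵥ ψ = ψ ⬝ᵥ A *ᵥ φ := by
    rw [dotProduct_mulVec, ← mulVec_transpose, hA.eq, dotProduct_comm]
  have key : s - t = φ ⬝ᵥ ((A + diagonal (Function.update w z s)) *ᵥ ψ)
      - ψ ⬝ᵥ ((A + diagonal (Function.update w z t)) *ᵥ φ) := by
    rw [add_mulVec, add_mulVec, dotProduct_add, dotProduct_add, hAsym, add_sub_add_left_eq_sub]
    simp only [dotProduct, mulVec_diagonal]
    rw [← Finset.sum_sub_distrib, Finset.sum_eq_single z]
    · simp [hψz, hφz]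
    · intro i _ hi
      simp only [Function.update_of_ne hi]; ring
    · simp
  have h1 := abs_dotProduct_le_of_abs_le_one (φ := (A + diagonal (Function.update w z s)) *ᵥ ψ) hφ
  have h2 := abs_dotProduct_le_of_abs_le_one (φ := (A + diagonal (Function.update w z t)) *ᵥ φ) hψ
  rw [← le_div_iff₀' hm] at hs ht
  rw [key]
  calc _ ≤ _ := abs_sub _ _
    _ ≤ 1 / m + 1 / m := add_le_add (h1.trans hs) (h2.trans ht)
    _ = 2 / m := by ring

theorem mem_iUnion_approxKernelSet {A : Matrix n n ℝ} {m : ℝ} {w g : n → ℝ} {z : n}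
    (hz : g z ≠ 0) (hmg : m * ∑ i, |((A + diagonal w) *ᵥ g) i| ≤ |g z|) :
    w ∈ ⋃ z, approxKernelSet A m z := by
  obtain ⟨y, -, hy⟩ := Finset.exists_max_image Finset.univ (fun i => |g i|) ⟨z, Finset.mem_univ z⟩
  have hzy := hy z (Finset.mem_univ z)
  have hpos : 0 < |g y| := (abs_pos.2 hz).trans_le hzy
  refine Set.mem_iUnion.2 ⟨y, (g y)⁻¹ • g, ?_, fun i => ?_, ?_⟩
  · simp [abs_pos.1 hpos]
  · rw [Pi.smul_apply, smul_eq_mul, abs_mul, abs_inv, inv_mul_le_iff₀ hpos, mul_one]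
    exact hy i (Finset.mem_univ i)
  · simp only [mulVec_smul, Pi.smul_apply, smul_eq_mul, abs_mul, abs_inv]
    rw [← Finset.mul_sum, mul_left_comm, inv_mul_le_iff₀ hpos, mul_one]
    exact hmg.trans hzy

/-- Away from the approximate kernel sets the matrix is invertible and the entries of its inverse
are below `m`. -/
theorem det_ne_zero_and_inv_lt {A : Matrix n n ℝ} {m : ℝ} (hm : 0 < m) {w : n → ℝ}
    (hw : w ∉ ⋃ z, approxKernelSet A m z) :
    (A + diagonal w).det ≠ 0 ∧ ∀ z y, |(A + diagonal w)⁻¹ z y| < m := by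
  have hdet : (A + diagonal w).det ≠ 0 := by
    intro h0
    obtain ⟨g, hg, hgK⟩ := exists_mulVec_eq_zero_iff.2 h0
    obtain ⟨z, hz⟩ := Function.ne_iff.1 hg
    exact hw (mem_iUnion_approxKernelSet hz (by simp [hgK]))
  refine ⟨hdet, fun z y => ?_⟩
  by_contra! hge
  have hK : (A + diagonal w) *ᵥ (fun i => (A + diagonal w)⁻¹ i y) = Pi.single y 1 := by
    have h1 := mul_nonsing_inv (A + diagonal w) (Ne.isUnit hdet)
    ext i
    have h2 := congrFun (congrFun h1 i) y
    rw [mul_apply] at h2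
    simp only [mulVec, dotProduct, h2, one_apply, Pi.single_apply]
  refine hw (mem_iUnion_approxKernelSet (z := z) (g := fun i => (A + diagonal w)⁻¹ i y)
    (abs_pos.1 (hm.trans_le hge)) ?_)
  rw [hK]
  simpa [Pi.single_apply, apply_ite abs] using hge

theorem le_abs_det_of_inv_lt {A : Matrix n n ℝ} {m : ℝ} (hm : 0 < m) {w : n → ℝ}
    (hw : w ∉ ⋃ z, approxKernelSet A m z) :
    ((Fintype.card n).factorial * m ^ Fintype.card n : ℝ)⁻¹ ≤ |(A + diagonal w).det| := by
  obtain ⟨hdet, hinv⟩ := det_ne_zero_and_inv_lt hm hw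
  have h := det_le (A := (A + diagonal w)⁻¹) (abv := AbsoluteValue.abs) (x := m)
    fun i j => (hinv i j).le
  rw [AbsoluteValue.abs_apply, det_nonsing_inv, Ring.inverse_eq_inv', abs_inv, nsmul_eq_mul] at h
  exact inv_le_of_inv_le₀ (abs_pos.2 hdet) h

/-- The Wegner estimate: with high probability the inverse is bounded. -/
theorem pi_iUnion_approxKernelSet_le {ν : n → Measure ℝ} [∀ i, IsProbabilityMeasure (ν i)]
    {C : ℝ}
    (hν : ∀ i, ∀ s t : ℝ, s ≤ t → ν i (Set.Icc s t) ≤ ENNReal.ofReal (C * (t - s)))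
    {A : Matrix n n ℝ} (hA : A.IsSymm) {m : ℝ} (hm : 0 < m) (u : n → ℝ) :
    Measure.pi ν {w | w - u ∈ ⋃ z, approxKernelSet A m z}
      ≤ ENNReal.ofReal (Fintype.card n * (C * (2 / m))) := by
  have h1 : ∀ z, Measure.pi ν {w | w - u ∈ approxKernelSet A m z}
      ≤ ENNReal.ofReal (C * (2 / m)) := by
    intro z
    refine pi_le_of_section_diam z (hν z) (by positivity) ?_ ?_
    · exact ((isClosed_approxKernelSet A m z).preimage
        (continuous_id.sub continuous_const)).measurableSet
    · intro w s t hs ht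
      have hsub : ∀ r, Function.update w z r - u = Function.update (w - u) z (r - u z) := by
        intro r; ext j
        by_cases hj : j = z
        · subst hj; simp
        · simp [hj]
      rw [Set.mem_ofPred_eq, hsub] at hs ht
      have := approxKernelSet_section hA hm z (w - u) _ _ hs ht
      rwa [sub_sub_sub_cancel_right] at this
  calc _ = Measure.pi ν (⋃ z ∈ (Finset.univ : Finset n), {w | w - u ∈ approxKernelSet A m z}) := by
        congr 1; ext w; simp
    _ ≤ ∑ z : n, Measure.pi ν {w | w - u ∈ approxKernelSet A m z} :=
        measure_biUnion_finset_le _ _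
    _ ≤ ∑ z : n, ENNReal.ofReal (C * (2 / m)) := Finset.sum_le_sum fun z _ => h1 z
    _ = _ := by
        rw [Finset.sum_const, nsmul_eq_mul, Finset.card_univ, ← ENNReal.ofReal_natCast,
          ← ENNReal.ofReal_mul (by positivity)]

/-! ### Resonant diagonals -/

open Classical in
/-- The numerators to be compared with the determinant: entries `(x, y)` of the adjugate for
`y ∈ Y`, and the constant `ε` in the slot `y = x`. -/
noncomputable def resonanceNumerator (A : Matrix n n ℝ) (x : n) (Y : Set n) (ε : ℝ) (y : n)
    (w : n → ℝ) : ℝ :=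
  if y = x then ε else if y ∈ Y then (A + diagonal w).adjugate x y else 0

/-- The diagonals `w` for which some entry `(x, y)`, `y ∈ Y`, of `(A + diagonal w)⁻¹` exceeds `a`,
or for which `|det (A + diagonal w)| < ε / a`. The second alternative makes the set an open
neighbourhood of the diagonals with singular `A + diagonal w`. -/
def resonantSet (A : Matrix n n ℝ) (x : n) (Y : Set n) (a ε : ℝ) : Set (n → ℝ) :=
  {w | ∃ y, a * |(A + diagonal w).det| < |resonanceNumerator A x Y ε y w|}

theorem isCoordAffine_resonanceNumerator (A : Matrix n n ℝ) (x : n) (Y : Set n) (ε : ℝ) (y : n) :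
    IsCoordAffine (resonanceNumerator A x Y ε y) := by
  unfold resonanceNumerator
  split_ifs
  exacts [isCoordAffine_const _, isCoordAffine_adjugate_add_diagonal A x y, isCoordAffine_const _]

theorem continuous_resonanceNumerator (A : Matrix n n ℝ) (x : n) (Y : Set n) (ε : ℝ) (y : n) :
    Continuous (resonanceNumerator A x Y ε y) := by
  unfold resonanceNumerator
  split_ifs
  exacts [continuous_const, continuous_adjugate_add_diagonal A x y, continuous_const]

theorem isOpen_resonantSet (A : Matrix n n ℝ) (x : n) (Y : Set n) (a ε : ℝ) :
    IsOpen (resonantSet A x Y a ε) := by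
  have : resonantSet A x Y a ε =
      ⋃ y, {w | a * |(A + diagonal w).det| < |resonanceNumerator A x Y ε y w|} := by
    ext w; simp [resonantSet]
  rw [this]
  exact isOpen_iUnion fun y => isOpen_lt
    (continuous_const.mul (continuous_det_add_diagonal A).abs)
    (continuous_resonanceNumerator A x Y ε y).abs

/-- Raising the energy from `e` to `e'` produces a new resonance with probability at most
proportional to `e' - e`. -/
theorem pi_resonantSet_crossing_le {ν : n → Measure ℝ} [∀ i, IsProbabilityMeasure (ν i)]
    {C a : ℝ} (hC : 0 ≤ C) (ha : 0 ≤ a)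
    (hν : ∀ i, ∀ s t : ℝ, s ≤ t → ν i (Set.Icc s t) ≤ ENNReal.ofReal (C * (t - s)))
    (A : Matrix n n ℝ) (x : n) (Y : Set n) (ε : ℝ) {e e' : ℝ} (he : e ≤ e') :
    Measure.pi ν {w | (w - fun _ => e') ∈ resonantSet A x Y a ε ∧
        (w - fun _ => e) ∉ resonantSet A x Y a ε}
      ≤ ENNReal.ofReal ((Fintype.card n : ℝ) ^ 2 * C * (e' - e)) := by
  set f : n → (n → ℝ) → ℝ := fun y w => resonanceNumerator A x Y ε y (w - fun _ => e)
  set g : (n → ℝ) → ℝ := fun w => (A + diagonal (w - fun _ => e)).det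
  have hfc : ∀ y, Continuous (f y) := fun y =>
    (continuous_resonanceNumerator A x Y ε y).comp (continuous_id.sub continuous_const)
  have hgc : Continuous g :=
    (continuous_det_add_diagonal A).comp (continuous_id.sub continuous_const)
  have hshift : ∀ w : n → ℝ, (w - fun _ => e' - e) - (fun _ => e) = w - fun _ => e' := by
    intro w; ext j; simp only [Pi.sub_apply]; ring
  calc _ ≤ Measure.pi ν (⋃ y ∈ (Finset.univ : Finset n),
          {w | a * |g (w - fun _ => e' - e)| < |f y (w - fun _ => e' - e)| ∧
            |f y w| ≤ a * |g w|}) := by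
        refine measure_mono fun w hw => ?_
        obtain ⟨⟨y, hy⟩, hw2⟩ := hw
        refine Set.mem_biUnion (Finset.mem_univ y) ⟨?_, ?_⟩
        · simp only [f, g, hshift]
          exact hy
        · by_contra! hlt
          exact hw2 ⟨y, hlt⟩
    _ ≤ ∑ y : n, Measure.pi ν {w | a * |g (w - fun _ => e' - e)| < |f y (w - fun _ => e' - e)| ∧
            |f y w| ≤ a * |g w|} := measure_biUnion_finset_le _ _
    _ ≤ ∑ y : n, ENNReal.ofReal (Fintype.card n * (C * (e' - e))) :=
        Finset.sum_le_sum fun y _ => pi_crossing_le hC hν (sub_nonneg.2 he) ha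
          ((isCoordAffine_resonanceNumerator A x Y ε y).comp_sub _)
          ((isCoordAffine_det_add_diagonal A).comp_sub _) (hfc y) hgc
    _ = _ := by
        rw [Finset.sum_const, nsmul_eq_mul, Finset.card_univ, ← ENNReal.ofReal_natCast,
          ← ENNReal.ofReal_mul (by positivity)]
        congr 1; ring

/-- If the inverse is bounded by `m` and the diagonal entry at `x` is larger than `r`, then row `x`
of the equation for the inverse bounds the entries `(x, y)`, `y ≠ x`, by `N m / r`, provided the
off-diagonal entries of that row are at most `1`. -/
theorem notMem_resonantSet {A : Matrix n n ℝ} {x : n} {Y : Set n} {a m r : ℝ} (ha : 0 ≤ a)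
    (hm : 0 < m) (hr : 0 < r) (hoff : ∀ z, z ≠ x → |A x z| ≤ 1)
    (har : Fintype.card n * m / r ≤ a) {w : n → ℝ} (hw : w ∉ ⋃ z, approxKernelSet A m z)
    (hwx : r < |A x x + w x|) :
    w ∉ resonantSet A x Y a
      (a * ((Fintype.card n).factorial * m ^ Fintype.card n : ℝ)⁻¹) := by
  obtain ⟨hdet, hinv⟩ := det_ne_zero_and_inv_lt hm hw
  have hdetle := le_abs_det_of_inv_lt hm hw
  rintro ⟨y, hy⟩
  unfold resonanceNumerator at hy
  split_ifs at hy with hyx hyY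
  · have hpos : 0 ≤ a * ((Fintype.card n).factorial * m ^ Fintype.card n : ℝ)⁻¹ := by positivity
    rw [abs_of_nonneg hpos] at hy
    exact absurd (mul_le_mul_of_nonneg_left hdetle ha) (not_le.2 hy)
  · have h1 := congrFun (congrFun (mul_nonsing_inv (A + diagonal w) (Ne.isUnit hdet)) x) y
    rw [one_apply_ne (Ne.symm hyx), mul_apply, ← Finset.add_sum_erase _ _ (Finset.mem_univ x)] at h1
    have h2 : |∑ z ∈ Finset.univ.erase x, (A + diagonal w) x z * (A + diagonal w)⁻¹ z y|
        ≤ Fintype.card n * m := by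
      calc _ ≤ ∑ z ∈ Finset.univ.erase x, |(A + diagonal w) x z * (A + diagonal w)⁻¹ z y| :=
            Finset.abs_sum_le_sum_abs _ _
        _ ≤ ∑ z ∈ Finset.univ.erase x, m := by
            refine Finset.sum_le_sum fun z hz => ?_
            have hzx := Finset.ne_of_mem_erase hz
            rw [abs_mul, Matrix.add_apply, diagonal_apply_ne' _ hzx, add_zero]
            exact (mul_le_of_le_one_left (abs_nonneg _) (hoff z hzx)).trans (hinv z y).le
        _ ≤ ∑ z : n, m := Finset.sum_le_sum_of_subset_of_nonneg (Finset.erase_subset _ _)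
            fun _ _ _ => hm.le
        _ = Fintype.card n * m := by simp
    rw [eq_neg_of_add_eq_zero_right h1, abs_neg, abs_mul, Matrix.add_apply, diagonal_apply_eq] at h2
    have h3 : |(A + diagonal w)⁻¹ x y| ≤ a := by
      refine le_trans ?_ har
      rw [le_div_iff₀' hr]
      exact (mul_le_mul_of_nonneg_right hwx.le (abs_nonneg _)).trans h2
    have h4 : (A + diagonal w).adjugate x y
        = (A + diagonal w).det * (A + diagonal w)⁻¹ x y := by
      rw [inv_def, Matrix.smul_apply, Ring.inverse_eq_inv', smul_eq_mul, mul_inv_cancel_left₀ hdet]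
    rw [h4, abs_mul, mul_comm a] at hy
    exact absurd (mul_le_mul_of_nonneg_left h3 (abs_nonneg _)) (not_le.2 hy)
  · rw [abs_zero] at hy
    exact absurd (mul_nonneg ha (abs_nonneg _)) (not_le.2 hy)

end VariableDiagonal

/-! ### Green functions of finite volume Hamiltonians -/

section GreenFunction

open Matrix

theorem hamiltonian_zero_isSymm {Z : Type u} (G : SimpleGraph Z) (Λ : Finset Z) :
    (Anderson.hamiltonian G 0 Λ).IsSymm := by
  ext x y
  simp only [transpose_apply, Anderson.hamiltonian, of_apply]
  by_cases hxy : x = y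
  · subst hxy; rfl
  · rw [if_neg hxy, if_neg (Ne.symm hxy)]
    by_cases h : G.Adj x y
    · rw [if_pos h, if_pos h.symm]
    · rw [if_neg h, if_neg fun h' => h h'.symm]

theorem abs_hamiltonian_zero_le_one {Z : Type u} (G : SimpleGraph Z) (Λ : Finset Z) {x y : Λ}
    (hxy : y ≠ x) : |Anderson.hamiltonian G 0 Λ x y| ≤ 1 := by
  simp only [Anderson.hamiltonian, of_apply, if_neg hxy.symm]
  split_ifs <;> simp

open Classical in
theorem hamiltonian_sub_smul_one {Z : Type u} (G : SimpleGraph Z) (v : Z → ℝ) (Λ : Finset Z)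
    (E : ℝ) : Anderson.hamiltonian G v Λ - E • (1 : Matrix Λ Λ ℝ)
      = Anderson.hamiltonian G 0 Λ + diagonal ((fun z : Λ => v z) - fun _ => E) := by
  ext x y
  by_cases hxy : x = y
  · subst hxy
    simp [Anderson.hamiltonian]
    ring
  · simp [Anderson.hamiltonian, hxy]

open Classical in
theorem mem_spectrum_hamiltonian_iff {Z : Type u} (G : SimpleGraph Z) (v : Z → ℝ) (Λ : Finset Z)
    (E : ℝ) : E ∈ spectrum ℝ (Anderson.hamiltonian G v Λ) ↔
      (Anderson.hamiltonian G 0 Λ + diagonal ((fun z : Λ => v z) - fun _ => E)).det = 0 := by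
  rw [← hamiltonian_sub_smul_one, spectrum.mem_iff, ← IsUnit.neg_iff, neg_sub,
    Algebra.algebraMap_eq_smul_one, isUnit_iff_isUnit_det, isUnit_iff_ne_zero, not_not]

open Classical in
/-- Cramer's rule for the Green function. -/
theorem greenAbs_eq_of_det_ne_zero {Z : Type u} (G : SimpleGraph Z) (v : Z → ℝ) (Λ : Finset Z)
    (x y : Λ) (E : ℝ)
    (h : (Anderson.hamiltonian G 0 Λ + diagonal ((fun z : Λ => v z) - fun _ => E)).det ≠ 0) :
    Anderson.greenAbs G v Λ x y E = ENNReal.ofReal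
      (|(Anderson.hamiltonian G 0 Λ + diagonal ((fun z : Λ => v z) - fun _ => E)).adjugate x y| /
        |(Anderson.hamiltonian G 0 Λ + diagonal ((fun z : Λ => v z) - fun _ => E)).det|) := by
  rw [Anderson.greenAbs, if_neg (by rwa [mem_spectrum_hamiltonian_iff]), hamiltonian_sub_smul_one,
    inv_def, Matrix.smul_apply, Ring.inverse_eq_inv', smul_eq_mul, abs_mul, abs_inv, div_eq_inv_mul]

variable {Z : Type u} {G : SimpleGraph Z} {C d : ℝ} (hG : Anderson.PolyGrowth G C d)

/-- The sites of the ball of radius `L` around `x` that have a neighbour outside the ball. -/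
def boundarySites (L : ℕ) (x : Z) : Set (Anderson.ball hG x L) :=
  {y | (y : Z) ∈ Anderson.innerBoundary G (Anderson.ball hG x L)}

open Classical in
/-- The potentials `w` on the ball around `x`, measured from the energy, that are resonant at
level `a`. The determinant is compared with the lower bound available when all entries of the
Green function are below `m`. -/
noncomputable def resonantPotentials (L : ℕ) (a m : ℝ) (x : Z) :
    Set (Anderson.ball hG x L → ℝ) :=
  resonantSet (Anderson.hamiltonian G 0 (Anderson.ball hG x L))
    ⟨x, Anderson.self_mem_ball hG x L⟩ (boundarySites hG L x) a
    (a * ((Fintype.card (Anderson.ball hG x L)).factorial *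
      m ^ Fintype.card (Anderson.ball hG x L) : ℝ)⁻¹)

open Classical in
/-- The potentials `w` on the ball around `x`, measured from the energy, for which the Hamiltonian
has an `ℓ¹`-approximate kernel vector of accuracy `m⁻¹`. They include those for which it is singular
or its Green function has an entry of modulus at least `m`. -/
noncomputable def nearlySingularPotentials (L : ℕ) (m : ℝ) (x : Z) :
    Set (Anderson.ball hG x L → ℝ) :=
  ⋃ z, approxKernelSet (Anderson.hamiltonian G 0 (Anderson.ball hG x L)) m z

/-- The centre of a ball of positive radius is not a boundary site. -/
theorem centre_notMem_boundarySites {L : ℕ} (hL : 1 ≤ L) (x : Z) :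
    (⟨x, Anderson.self_mem_ball hG x L⟩ : Anderson.ball hG x L) ∉ boundarySites hG L x := by
  rintro ⟨-, z, hz, hadj⟩
  refine hz ((Anderson.mem_ball hG).2 ?_)
  rw [SimpleGraph.dist_eq_one_iff_adj.2 hadj]
  exact hL

theorem mem_resonantPotentials_of_lt_greenMax {L : ℕ} (hL : 1 ≤ L) {a m : ℝ} (ha : 0 < a)
    (hm : 0 < m) {x : Z} {v : Z → ℝ} {E : ℝ}
    (h : ENNReal.ofReal a < Anderson.greenMax hG v L x E) :
    (fun z : Anderson.ball hG x L => v z) - (fun _ => E) ∈ resonantPotentials hG L a m x := by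
  classical
  obtain ⟨y, hy⟩ := lt_iSup_iff.1 h
  obtain ⟨hyb, hy⟩ := lt_iSup_iff.1 hy
  have hne : y ≠ ⟨x, Anderson.self_mem_ball hG x L⟩ := by
    rintro rfl
    exact centre_notMem_boundarySites hG hL x hyb
  by_cases hdet : (Anderson.hamiltonian G 0 (Anderson.ball hG x L)
      + diagonal ((fun z : Anderson.ball hG x L => v z) - fun _ => E)).det = 0
  · refine ⟨⟨x, Anderson.self_mem_ball hG x L⟩, ?_⟩
    rw [resonanceNumerator, if_pos rfl, hdet, abs_zero, mul_zero]
    positivity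
  · refine ⟨y, ?_⟩
    rw [greenAbs_eq_of_det_ne_zero _ _ _ _ _ _ hdet, ENNReal.ofReal_lt_ofReal_iff_of_nonneg ha.le,
      lt_div_iff₀ (abs_pos.2 hdet)] at hy
    rwa [resonanceNumerator, if_neg hne, if_pos (show y ∈ boundarySites hG L x from hyb)]

theorem le_greenMax_or_mem_nearlySingularPotentials {L : ℕ} {a m : ℝ} (ha : 0 < a)
    (hm : 0 < m) {x : Z} {v : Z → ℝ} {E : ℝ}
    (h : (fun z : Anderson.ball hG x L => v z) - (fun _ => E) ∈ resonantPotentials hG L a m x) :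
    ENNReal.ofReal a ≤ Anderson.greenMax hG v L x E ∨
      (fun z : Anderson.ball hG x L => v z) - (fun _ => E) ∈ nearlySingularPotentials hG L m x := by
  classical
  rw [or_iff_not_imp_right]
  intro hns
  have hdet := (det_ne_zero_and_inv_lt hm hns).1
  have hdetle := le_abs_det_of_inv_lt hm hns
  obtain ⟨y, hy⟩ := h
  unfold resonanceNumerator at hy
  split_ifs at hy with hyx hyY
  · have hpos : 0 ≤ a * ((Fintype.card (Anderson.ball hG x L)).factorial *
      m ^ Fintype.card (Anderson.ball hG x L) : ℝ)⁻¹ := by positivity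
    rw [abs_of_nonneg hpos] at hy
    exact absurd (mul_le_mul_of_nonneg_left hdetle ha.le) (not_le.2 hy)
  · refine le_trans ?_ (le_iSup₂_of_le y hyY le_rfl)
    rw [greenAbs_eq_of_det_ne_zero _ _ _ _ _ _ hdet]
    exact ENNReal.ofReal_le_ofReal ((le_div_iff₀ (abs_pos.2 hdet)).2 hy.le)
  · rw [abs_zero] at hy
    exact absurd (mul_nonneg ha.le (abs_nonneg _)) (not_le.2 hy)

theorem isOpen_resonantPotentials (L : ℕ) (a m : ℝ) (x : Z) :
    IsOpen (resonantPotentials hG L a m x) := by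
  classical
  exact isOpen_resonantSet _ _ _ _ _

theorem natCast_card_ball_le {L : ℕ} (hL : 1 ≤ L) (x : Z) :
    ((Fintype.card (Anderson.ball hG x L) : ℕ) : ℝ) ≤ C * (L : ℝ) ^ d := by
  have h := hG.card_ball_le x L hL
  rwa [Set.ncard_eq_toFinset_card _ (hG.finite x L), ← Fintype.card_coe] at h

end GreenFunction

/-! ### Resonance events -/

section ResonanceEvent

variable {Z : Type u} {G : SimpleGraph Z} {C_d d : ℝ} (hG : Anderson.PolyGrowth G C_d d)
  {Ω : Type v} [MeasurableSpace Ω] {μ : Measure Ω} [IsProbabilityMeasure μ]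
  {V : Z → Ω → ℝ} {C_W : ℝ}

theorem measure_map_Icc_le (hV : Anderson.IsLipschitzIID μ V C_W) (z : Z) {s t : ℝ} (hst : s ≤ t) :
    (μ.map (V z)) (Set.Icc s t) ≤ ENNReal.ofReal (C_W * (t - s)) := by
  have := Measure.isProbabilityMeasure_map (μ := μ) (hV.measurable z).aemeasurable
  exact measure_Icc_le_of_cdf_lipschitz (hV.lipschitz z) hst

/-- The restriction of the random potential to a finite set has a product law. -/
theorem map_restrict_eq_pi (hV : Anderson.IsLipschitzIID μ V C_W) (Λ : Finset Z) :
    μ.map (fun ω (u : Λ) => V u ω) = Measure.pi fun u : Λ => μ.map (V u) :=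
  (iIndepFun_iff_map_fun_eq_pi_map fun u : Λ => (hV.measurable u).aemeasurable).1
    (hV.indep.precomp Subtype.val_injective)

omit [IsProbabilityMeasure μ] in
theorem measurable_restrict (hV : Anderson.IsLipschitzIID μ V C_W) (Λ : Finset Z) :
    Measurable fun ω (u : Λ) => V u ω :=
  measurable_pi_lambda _ fun u => hV.measurable u

theorem measure_restrict_mem (hV : Anderson.IsLipschitzIID μ V C_W) (Λ : Finset Z)
    {B : Set (Λ → ℝ)} (hB : MeasurableSet B) :
    μ {ω | (fun u : Λ => V u ω) ∈ B} = Measure.pi (fun u : Λ => μ.map (V u)) B := by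
  rw [← map_restrict_eq_pi hV, Measure.map_apply (measurable_restrict hV Λ) hB]
  rfl

variable (V) in
/-- The event that the ball around `x` is resonant at the energy `e`. -/
def resonanceEvent (L : ℕ) (a m : ℝ) (x : Z) (e : ℝ) : Set Ω :=
  {ω | (fun u : Anderson.ball hG x L => V u ω) - (fun _ => e) ∈ resonantPotentials hG L a m x}

omit [MeasurableSpace Ω] in
theorem mem_resonanceEvent_of_lt_greenMax {L : ℕ} (hL : 1 ≤ L) {a m : ℝ} (ha : 0 < a)
    (hm : 0 < m) {x : Z} {ω : Ω} {e : ℝ}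
    (h : ENNReal.ofReal a < Anderson.greenMax hG (fun z => V z ω) L x e) :
    ω ∈ resonanceEvent hG V L a m x e :=
  mem_resonantPotentials_of_lt_greenMax hG (v := fun z => V z ω) hL ha hm h

omit [MeasurableSpace Ω] in
theorem setOf_exists_lt_min_greenMax_subset {L : ℕ} (hL : 1 ≤ L) {a m : ℝ} (ha : 0 < a)
    (hm : 0 < m) (I : Set ℝ) (x y : Z) :
    {ω | ∃ E ∈ I, ENNReal.ofReal a <
        min (Anderson.greenMax hG (fun z => V z ω) L x E)
          (Anderson.greenMax hG (fun z => V z ω) L y E)} ⊆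
      ⋃ e ∈ I, resonanceEvent hG V L a m x e ∩ resonanceEvent hG V L a m y e := by
  rintro ω ⟨E, hE, hlt⟩
  exact Set.mem_biUnion hE
    ⟨mem_resonanceEvent_of_lt_greenMax hG hL ha hm (lt_min_iff.1 hlt).1,
      mem_resonanceEvent_of_lt_greenMax hG hL ha hm (lt_min_iff.1 hlt).2⟩

theorem measurableSet_sub_const_mem_resonantPotentials (L : ℕ) (a m : ℝ) (x : Z) (e : ℝ) :
    MeasurableSet {w : Anderson.ball hG x L → ℝ |
      w - (fun _ => e) ∈ resonantPotentials hG L a m x} :=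
  ((isOpen_resonantPotentials hG L a m x).preimage
    (continuous_id.sub continuous_const)).measurableSet

omit [MeasurableSpace Ω] in
theorem isOpen_setOf_mem_resonanceEvent (L : ℕ) (a m : ℝ) (x : Z) (ω : Ω) :
    IsOpen {e | ω ∈ resonanceEvent hG V L a m x e} :=
  (isOpen_resonantPotentials hG L a m x).preimage
    (f := fun e : ℝ => (fun u : Anderson.ball hG x L => V u ω) - fun _ => e) (by fun_prop)

theorem measure_nearlySingular_le (hV : Anderson.IsLipschitzIID μ V C_W) (L : ℕ) {m : ℝ}
    (hm : 0 < m) (x : Z) (e : ℝ) :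
    μ {ω | (fun u : Anderson.ball hG x L => V u ω) - (fun _ => e) ∈
        nearlySingularPotentials hG L m x}
      ≤ ENNReal.ofReal (Fintype.card (Anderson.ball hG x L) * (C_W * (2 / m))) := by
  classical
  have := fun u : Anderson.ball hG x L =>
    Measure.isProbabilityMeasure_map (μ := μ) (hV.measurable u).aemeasurable
  have hcl : IsClosed (nearlySingularPotentials hG L m x) :=
    isClosed_iUnion_of_finite fun z => isClosed_approxKernelSet _ _ _
  refine (measure_restrict_mem hV _ (B := {w | w - (fun _ => e) ∈
    nearlySingularPotentials hG L m x})
    (hcl.preimage (continuous_id.sub continuous_const)).measurableSet).trans_le ?_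
  exact pi_iUnion_approxKernelSet_le (ν := fun u : Anderson.ball hG x L => μ.map (V u))
    (fun u s t hst => measure_map_Icc_le hV u hst)
    (hamiltonian_zero_isSymm G _) hm _

theorem measure_resonanceEvent_le (hV : Anderson.IsLipschitzIID μ V C_W) (L : ℕ) {a m P : ℝ}
    (ha : 0 < a) (hm : 0 < m) (hP : 0 ≤ P) (hC_W : 0 ≤ C_W) (x : Z) {e : ℝ}
    (hfixed : μ {ω | ENNReal.ofReal a ≤ Anderson.greenMax hG (fun z => V z ω) L x e}
      ≤ ENNReal.ofReal P) :
    μ (resonanceEvent hG V L a m x e) ≤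
      ENNReal.ofReal (P + Fintype.card (Anderson.ball hG x L) * (C_W * (2 / m))) := by
  rw [ENNReal.ofReal_add hP (by positivity)]
  refine le_trans (measure_mono ?_) ((measure_union_le _ _).trans
    (add_le_add hfixed (measure_nearlySingular_le hG hV L hm x e)))
  exact fun ω hω => le_greenMax_or_mem_nearlySingularPotentials hG ha hm hω

theorem measure_resonanceEvent_diff_le (hV : Anderson.IsLipschitzIID μ V C_W) (hC_W : 0 ≤ C_W)
    (L : ℕ) {a : ℝ} (ha : 0 ≤ a) (m : ℝ) (x : Z) {e e' : ℝ} (he : e ≤ e') :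
    μ (resonanceEvent hG V L a m x e' \ resonanceEvent hG V L a m x e) ≤
      ENNReal.ofReal ((Fintype.card (Anderson.ball hG x L) : ℝ) ^ 2 * C_W * (e' - e)) := by
  classical
  have := fun u : Anderson.ball hG x L =>
    Measure.isProbabilityMeasure_map (μ := μ) (hV.measurable u).aemeasurable
  refine (measure_restrict_mem hV _ (B := {w | w - (fun _ => e') ∈ resonantPotentials hG L a m x ∧
    w - (fun _ => e) ∉ resonantPotentials hG L a m x})
    ((measurableSet_sub_const_mem_resonantPotentials hG L a m x e').diff
      (measurableSet_sub_const_mem_resonantPotentials hG L a m x e))).trans_le ?_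
  exact pi_resonantSet_crossing_le (ν := fun u : Anderson.ball hG x L => μ.map (V u)) hC_W ha
    (fun u s t hst => measure_map_Icc_le hV u hst)
    _ _ _ _ he

/-- At a fixed energy a ball is resonant at a level `a ≥ N m / r` only if its Green function has an
entry of size about `m`, or if the diagonal entry at the centre is at most `r`. -/
theorem measure_resonanceEvent_le_wegner (hV : Anderson.IsLipschitzIID μ V C_W) (hC_W : 0 ≤ C_W)
    (L : ℕ) {a m r : ℝ} (ha : 0 ≤ a) (hm : 0 < m) (hr : 0 < r) (x : Z)
    (har : Fintype.card (Anderson.ball hG x L) * m / r ≤ a) (e : ℝ) :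
    μ (resonanceEvent hG V L a m x e) ≤ ENNReal.ofReal
      (Fintype.card (Anderson.ball hG x L) * (C_W * (2 / m)) + C_W * (2 * r)) := by
  classical
  set q : ℝ := Anderson.hamiltonian G 0 (Anderson.ball hG x L)
    ⟨x, Anderson.self_mem_ball hG x L⟩ ⟨x, Anderson.self_mem_ball hG x L⟩ with hq
  have hdiag : μ (V x ⁻¹' Set.Icc (e - q - r) (e - q + r)) ≤ ENNReal.ofReal (C_W * (2 * r)) := by
    rw [← Measure.map_apply (hV.measurable x) measurableSet_Icc]
    refine (measure_map_Icc_le hV x (by linarith)).trans_eq ?_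
    congr 2; ring
  rw [ENNReal.ofReal_add (by positivity) (by positivity)]
  refine le_trans (measure_mono fun ω hω => ?_) ((measure_union_le _ _).trans
    (add_le_add (measure_nearlySingular_le hG hV L hm x e) hdiag))
  by_contra hnot
  rw [Set.mem_union, not_or] at hnot
  refine notMem_resonantSet ha hm hr (fun z hz => abs_hamiltonian_zero_le_one G _ hz) har
    hnot.1 ?_ hω
  by_contra! hle
  rw [← hq, Pi.sub_apply] at hle
  exact hnot.2 ⟨by linarith [(abs_le.1 hle).1], by linarith [(abs_le.1 hle).2]⟩

/-- Resonances of disjoint balls are independent, so that a new resonance of the first ball while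
the second one is resonant costs the product of the two bounds. -/
theorem measure_diff_inter_resonanceEvent_le (hV : Anderson.IsLipschitzIID μ V C_W)
    (hC_W : 0 ≤ C_W) (L : ℕ) {a m p : ℝ} (ha : 0 ≤ a) {x y : Z}
    (hxy : Disjoint (Anderson.ball hG x L) (Anderson.ball hG y L)) {e e' : ℝ} (he : e ≤ e')
    (hp : μ (resonanceEvent hG V L a m y e') ≤ ENNReal.ofReal p) :
    μ ((resonanceEvent hG V L a m x e' \ resonanceEvent hG V L a m x e) ∩
        resonanceEvent hG V L a m y e')
      ≤ ENNReal.ofReal ((Fintype.card (Anderson.ball hG x L) : ℝ) ^ 2 * C_W * (e' - e) * p) := by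
  have hind := hV.indep.indepFun_finset _ _ hxy hV.measurable
  have h := hind.measure_inter_preimage_eq_mul _ _
    ((measurableSet_sub_const_mem_resonantPotentials hG L a m x e').diff
      (measurableSet_sub_const_mem_resonantPotentials hG L a m x e))
    (measurableSet_sub_const_mem_resonantPotentials hG L a m y e')
  rw [ENNReal.ofReal_mul (mul_nonneg (by positivity) (sub_nonneg.2 he))]
  exact h.trans_le (mul_le_mul' (measure_resonanceEvent_diff_le hG hV hC_W L ha m x he) hp)

/-- The probability that two disjoint balls are resonant at a common energy in an interval. -/
theorem measure_biUnion_inter_resonanceEvent_le (hV : Anderson.IsLipschitzIID μ V C_W)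
    (hC_W : 0 ≤ C_W) (L : ℕ) {a m p : ℝ} (ha : 0 ≤ a) (hp : 0 ≤ p) {I : Set ℝ}
    (hlen : ∀ e ∈ I, ∀ e' ∈ I, e' - e ≤ 1) {x y : Z}
    (hxy : Disjoint (Anderson.ball hG x L) (Anderson.ball hG y L))
    (hx : ∀ e ∈ I, μ (resonanceEvent hG V L a m x e) ≤ ENNReal.ofReal p)
    (hy : ∀ e ∈ I, μ (resonanceEvent hG V L a m y e) ≤ ENNReal.ofReal p) :
    μ (⋃ e ∈ I, resonanceEvent hG V L a m x e ∩ resonanceEvent hG V L a m y e) ≤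
      ENNReal.ofReal (p + ((Fintype.card (Anderson.ball hG x L) : ℝ) ^ 2 +
        (Fintype.card (Anderson.ball hG y L) : ℝ) ^ 2) * C_W * p) := by
  refine measure_biUnion_le_of_crossing hp (by positivity)
    (fun e he => (measure_mono Set.inter_subset_left).trans (hx e he)) ?_ hlen fun ω =>
      (isOpen_setOf_mem_resonanceEvent hG L a m x ω).inter
        (isOpen_setOf_mem_resonanceEvent hG L a m y ω)
  intro e _ e' he' hee'
  have hle := sub_nonneg.2 hee'
  calc _ ≤ μ (((resonanceEvent hG V L a m x e' \ resonanceEvent hG V L a m x e) ∩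
          resonanceEvent hG V L a m y e') ∪
        ((resonanceEvent hG V L a m y e' \ resonanceEvent hG V L a m y e) ∩
          resonanceEvent hG V L a m x e')) := by
        refine measure_mono fun ω hω => ?_
        by_cases h1 : ω ∈ resonanceEvent hG V L a m x e
        · exact Or.inr ⟨⟨hω.1.2, fun h2 => hω.2 ⟨h1, h2⟩⟩, hω.1.1⟩
        · exact Or.inl ⟨⟨hω.1.1, h1⟩, hω.1.2⟩
    _ ≤ _ := measure_union_le _ _
    _ ≤ _ := add_le_add
        (measure_diff_inter_resonanceEvent_le hG hV hC_W L ha hxy hee' (hy e' he'))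
        (measure_diff_inter_resonanceEvent_le hG hV hC_W L ha hxy.symm hee' (hx e' he'))
    _ = _ := by
        rw [← ENNReal.ofReal_add (by positivity) (by positivity)]
        congr 1; ring

/-- The probability that a ball is resonant somewhere in an interval, for a level above the typical
size of the Green function. -/
theorem measure_biUnion_resonanceEvent_le (hV : Anderson.IsLipschitzIID μ V C_W)
    (hC_W : 0 ≤ C_W) (L : ℕ) {a m r : ℝ} (ha : 0 ≤ a) (hm : 0 < m) (hr : 0 < r) {I : Set ℝ}
    (hlen : ∀ e ∈ I, ∀ e' ∈ I, e' - e ≤ 1) (x : Z)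
    (har : Fintype.card (Anderson.ball hG x L) * m / r ≤ a) :
    μ (⋃ e ∈ I, resonanceEvent hG V L a m x e) ≤
      ENNReal.ofReal (Fintype.card (Anderson.ball hG x L) * (C_W * (2 / m)) + C_W * (2 * r)
        + (Fintype.card (Anderson.ball hG x L) : ℝ) ^ 2 * C_W) :=
  measure_biUnion_le_of_crossing (by positivity) (by positivity)
    (fun e _ => measure_resonanceEvent_le_wegner hG hV hC_W L ha hm hr x har e)
    (fun _ _ _ _ he => measure_resonanceEvent_diff_le hG hV hC_W L ha m x he) hlen
    (isOpen_setOf_mem_resonanceEvent hG L a m x)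

end ResonanceEvent

/-! ### Two-volume resonances -/

theorem mainTheorem2 {Z : Type u} [Countable Z] (G : SimpleGraph Z) (hconn : G.Connected)
    {C_d d : ℝ} (hG : Anderson.PolyGrowth G C_d d)
    {Ω : Type v} [MeasurableSpace Ω] (μ : Measure Ω) [IsProbabilityMeasure μ]
    (V : Z → Ω → ℝ) {C_W : ℝ} (hC_W : 0 < C_W) (hV : Anderson.IsLipschitzIID μ V C_W)
    (L : ℕ) (hL : 1 ≤ L) (I : Set ℝ) (hI : I.OrdConnected) (hI_len : volume I ≤ 1)
    (a b c P_L : ℝ) (ha : 0 < a) (hb : 0 < b) (hc : 0 < c) (hP_L : 0 < P_L)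
    (habc : ∀ u : Z, b ≤ min (((Anderson.ball hG u L).card : ℝ)⁻¹ * (a * c ^ 2)) c)
    (hfixed : ∀ E ∈ I, ∀ x : Z,
      μ {ω | ENNReal.ofReal a ≤ Anderson.greenMax hG (fun z => V z ω) L x E}
        ≤ ENNReal.ofReal P_L)
    (x y : Z) (hxy : Disjoint (Anderson.ball hG x L) (Anderson.ball hG y L)) :
    μ {ω | ∃ E ∈ I, ENNReal.ofReal a <
        min (Anderson.greenMax hG (fun z => V z ω) L x E)
          (Anderson.greenMax hG (fun z => V z ω) L y E)}
      ≤ ENNReal.ofReal (4 * C_W * C_d ^ 2 * (L : ℝ) ^ (2 * d) * c + 2 * P_L / b) := by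
  have hlen := sub_le_one_of_volume_le hI hI_len
  set K : ℝ := C_d * (L : ℝ) ^ d with hK
  have hKsq : C_d ^ 2 * (L : ℝ) ^ (2 * d) = K ^ 2 := by
    rw [hK, mul_pow, ← Real.rpow_natCast ((L : ℝ) ^ d) 2, ← Real.rpow_mul (Nat.cast_nonneg L),
      mul_comm 2 d]
    norm_num
  have hT : 4 * C_W * C_d ^ 2 * (L : ℝ) ^ (2 * d) * c = 4 * C_W * K ^ 2 * c := by
    rw [← hKsq]; ring
  rw [hT]
  have hcard : ∀ z : Z, (1 : ℝ) ≤ Fintype.card (Anderson.ball hG z L) := fun z => by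
    have : Nonempty (Anderson.ball hG z L) := ⟨⟨z, Anderson.self_mem_ball hG z L⟩⟩
    exact_mod_cast (Fintype.card_pos : 0 < Fintype.card (Anderson.ball hG z L))
  have hNx := natCast_card_ball_le hG hL x
  have hNy := natCast_card_ball_le hG hL y
  rw [← hK] at hNx hNy
  set N : ℝ := (Fintype.card (Anderson.ball hG x L) : ℝ) with hN
  set N' : ℝ := (Fintype.card (Anderson.ball hG y L) : ℝ) with hN'
  have hN1 : 1 ≤ N := hcard x
  have hK1 : 1 ≤ K := hN1.trans hNx
  have hNK : N ^ 2 ≤ K ^ 2 := pow_le_pow_left₀ (by linarith) hNx 2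
  have hNK' : N' ^ 2 ≤ K ^ 2 := pow_le_pow_left₀ (by linarith) hNy 2
  have hbc : b ≤ c := (habc x).trans (min_le_right _ _)
  have hPb : 0 < 2 * P_L / b := by positivity
  -- if the first term of the bound is at least one there is nothing to prove; otherwise `b ≤ c`
  -- makes `2 K² C_W` smaller than `1 / (2 b)`
  rcases le_or_gt 1 (4 * C_W * K ^ 2 * c) with hbig | hsmall
  · refine prob_le_one.trans ?_
    rw [← ENNReal.ofReal_one]
    exact ENNReal.ofReal_le_ofReal (by linarith)
  have hsub := fun (m : ℝ) (hm : 0 < m) =>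
    setOf_exists_lt_min_greenMax_subset hG (V := V) hL ha hm I x y
  rcases le_or_gt b (3 / 2) with hb32 | hb32
  -- for `b ≤ 3 / 2` crossings of one ball while the other one is resonant are rare enough
  · set D : ℝ := 1 + 2 * K ^ 2 * C_W with hD
    have hDpos : 0 < D := by positivity
    have hDb : D ≤ 2 / b := by
      rw [le_div_iff₀ hb, hD]
      have h1 : 4 * C_W * K ^ 2 * b ≤ 4 * C_W * K ^ 2 * c := by gcongr
      linarith
    -- `m` makes the Wegner contribution `2 K C_W D / m` equal to the first term of the bound
    set m : ℝ := 2 * K * C_W * D / (4 * C_W * K ^ 2 * c) with hm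
    have hmpos : 0 < m := by positivity
    set p : ℝ := P_L + K * (C_W * (2 / m)) with hp
    have hppos : 0 < p := by positivity
    have hpD : p * D = P_L * D + 4 * C_W * K ^ 2 * c := by
      rw [hp, add_mul, hm]
      field_simp
    have hR : ∀ z, (Fintype.card (Anderson.ball hG z L) : ℝ) ≤ K → ∀ e ∈ I,
        μ (resonanceEvent hG V L a m z e) ≤ ENNReal.ofReal p := by
      intro z hz e he
      refine (measure_resonanceEvent_le hG hV L ha hmpos hP_L.le hC_W.le z
        (hfixed e he z)).trans (ENNReal.ofReal_le_ofReal ?_)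
      rw [hp]
      gcongr
    refine (measure_mono (hsub m hmpos)).trans
      ((measure_biUnion_inter_resonanceEvent_le hG hV hC_W.le L ha.le hppos.le hlen hxy
        (hR x hNx) (hR y hNy)).trans (ENNReal.ofReal_le_ofReal ?_))
    calc p + (N ^ 2 + N' ^ 2) * C_W * p ≤ p + (K ^ 2 + K ^ 2) * C_W * p := by gcongr
      _ = p * D := by rw [hD]; ring
      _ = P_L * D + 4 * C_W * K ^ 2 * c := hpD
      _ ≤ P_L * (2 / b) + 4 * C_W * K ^ 2 * c := by gcongr
      _ = _ := by ring
  -- for `b > 3 / 2` the level `a` is so large that a single ball is unlikely to be resonant anywhere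
  -- in `I`; the Wegner estimate is used with `m = 3 / (2 c)` and the centre entry above `r = c`
  · have hmpos : 0 < 3 / 2 / c := by positivity
    have har : N * (3 / 2 / c) / c ≤ a := by
      have h1 := (habc x).trans (min_le_left _ _)
      rw [← Fintype.card_coe, ← hN, le_inv_mul_iff₀ (by linarith)] at h1
      rw [mul_div_assoc, div_div, ← sq, ← mul_div_assoc, div_le_iff₀ (by positivity)]
      refine le_trans ?_ h1
      gcongr
    refine (measure_mono ((hsub _ hmpos).trans
      (Set.iUnion₂_mono fun e _ => Set.inter_subset_left))).trans
      ((measure_biUnion_resonanceEvent_le hG hV hC_W.le L ha.le hmpos hc hlen x har).trans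
        (ENNReal.ofReal_le_ofReal ?_))
    rw [← hN]
    have hNsq : N ≤ N ^ 2 := by nlinarith
    have e1 : N * (C_W * (2 / (3 / 2 / c))) = 4 / 3 * (C_W * c) * N := by field_simp; norm_num
    have e2 : N ^ 2 * C_W ≤ 2 / 3 * (C_W * c) * N ^ 2 := by
      have : 1 ≤ 2 / 3 * c := by linarith
      nlinarith [mul_le_mul_of_nonneg_left this (by positivity : 0 ≤ N ^ 2 * C_W)]
    have e3 : C_W * c * N ≤ C_W * c * K ^ 2 := by gcongr; linarith
    have e4 : C_W * c * N ^ 2 ≤ C_W * c * K ^ 2 := by gcongr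
    have e5 : C_W * c * 1 ≤ C_W * c * K ^ 2 := by gcongr; nlinarith
    linarith
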